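/- For $S,x\in\{0,1\}^n=\mathbb{F}_2^n$ let $\chi_S(x)=(-1)^{S\cdot x}$, and for $c:\{0,1\}^n\to\{\pm1\}$ let $\widehat c(S)=2^{-n}\sum_{x}c(x)\chi_S(x)$. Call $c$ \emph{$k$-Fourier-sparse} if $\widehat c(S)\neq 0$ for at most $k$ vectors $S$; the \emph{Fourier dimension} of $c$ is the dimension over $\mathbb{F}_2$ of the span of $\{S:\widehat c(S)\neq 0\}$. A \emph{uniform quantum example} for $c$ is the $(n+1)$-qubit state $|\psi_c\rangle=2^{-n/2}\sum_{x\in\{0,1\}^n}|x,c(x)\rangle$. A \emph{quantum learner from $T$ uniform quantum examples} is a quantum measurement (POVM) $\{E_h\}$ on the space of $T$ examples, with outcomes $h$ ranging over all functions $\{0,1\}^n\to\{\pm1\}$; on target $c$ it outputs $h$ with probability $\langle\psi_c^{\otimes T}|E_h|\psi_c^{\otimes T}\rangle$. Theorem. There is an absolute constant $C>0$ such that for all integers $n\ge 0$, $k\ge 2$ and $r\ge 1$ there are an integer $0\le T\le C\,rk\log_2 k$ and a quantum learner from $T$ uniform quantum examples (depending only on $n,k,r$) such that, for every $k$-Fourier-sparse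 $c:\{0,1\}^n\to\{\pm1\}$ of Fourier dimension at most $r$, the learner on target $c$ outputs exactly $c$ with probability at least $2/3$. -/

import Mathlib

noncomputable section

namespace QLearn

open Matrix
open scoped ComplexOrder

/-- The Boolean cube `{0,1}^n`, as the vector space `𝔽₂ⁿ`. -/
abbrev Cube (n : ℕ) : Type := Fin n → ZMod 2

/-- Boolean functions `{0,1}^n → {±1}`; `ℤˣ` is the two-element set `{1, -1}`. -/
abbrev Concept (n : ℕ) : Type := Cube n → ℤˣ

/-- The character `χ_S(x) = (-1)^{S·x}`. -/
def character {n : ℕ} (S x : Cube n) : ℝ := (-1) ^ (S ⬝ᵥ x).val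

/-- The Fourier coefficient `f̂(S) = 𝔼_x [f(x) χ_S(x)]`, with `x` uniform. -/
def fourierCoeff {n : ℕ} (f : Cube n → ℝ) (S : Cube n) : ℝ :=
  (∑ x, f x * character S x) / 2 ^ n

/-- The Fourier support `{S : f̂(S) ≠ 0}`. -/
def fourierSupport {n : ℕ} (f : Cube n → ℝ) : Set (Cube n) := {S | fourierCoeff f S ≠ 0}

/-- `f` is `k`-Fourier-sparse if its Fourier support has at most `k` elements. -/
def IsFourierSparse {n : ℕ} (k : ℕ) (f : Cube n → ℝ) : Prop := (fourierSupport f).ncard ≤ k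

/-- The Fourier span: the `𝔽₂`-linear span of the Fourier support. -/
def fourierSpan {n : ℕ} (f : Cube n → ℝ) : Submodule (ZMod 2) (Cube n) :=
  Submodule.span (ZMod 2) (fourierSupport f)

/-- The Fourier dimension: the dimension over `𝔽₂` of the Fourier span. -/
def fourierDim {n : ℕ} (f : Cube n → ℝ) : ℕ := Module.finrank (ZMod 2) (fourierSpan f)

/-- A Boolean function regarded as a real-valued function. -/
def Concept.toReal {n : ℕ} (c : Concept n) : Cube n → ℝ := fun x => ((c x : ℤ) : ℝ)

/-- Labels `(x, b)` of the computational basis `|x, b⟩` of the `n+1` qubits of one example. -/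
abbrev ExampleBasis (n : ℕ) : Type := Cube n × ℤˣ

/-- The uniform quantum example `2^{-n/2} ∑_x |x, c(x)⟩`, by its amplitudes. -/
def quantumExample {n : ℕ} (c : Concept n) : ExampleBasis n → ℂ :=
  fun p => if p.2 = c p.1 then ((1 / Real.sqrt (2 ^ n) : ℝ) : ℂ) else 0

/-- `T` copies of the uniform quantum example: the amplitudes of the `T`-fold tensor power, in the
product basis `|s 0⟩ ⊗ ⋯ ⊗ |s (T-1)⟩`. -/
def quantumExamples {n : ℕ} (c : Concept n) (T : ℕ) : (Fin T → ExampleBasis n) → ℂ :=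
  fun s => ∏ i, quantumExample c (s i)

/-- A quantum learner that uses `T` quantum examples and outputs a hypothesis on `n` bits: a general
quantum measurement (POVM) of the `T` examples, whose outcomes are the hypotheses. -/
structure QuantumLearner (n T : ℕ) where
  /-- the measurement operator of each hypothesis -/
  effect : Concept n → Matrix (Fin T → ExampleBasis n) (Fin T → ExampleBasis n) ℂ
  posSemidef : ∀ h, (effect h).PosSemidef
  sum_effect : ∑ h, effect h = 1

/-- The probability that the learner outputs `h` when it is given `T` copies of the uniform quantum
example of `c`, by Born's rule: `⟨ψ| E_h |ψ⟩` for `ψ = ψ_c^{⊗T}`. -/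
def QuantumLearner.outputProb {n T : ℕ} (L : QuantumLearner n T) (c h : Concept n) : ℝ :=
  (star (quantumExamples c T) ⬝ᵥ (L.effect h *ᵥ quantumExamples c T)).re

/-- The learner exactly learns the class `𝒞` with error probability at most `δ`: for every target
`c ∈ 𝒞`, the hypothesis it outputs is `c` itself with probability at least `1 - δ`. -/
def QuantumLearner.ExactlyLearns {n T : ℕ} (L : QuantumLearner n T) (𝒞 : Set (Concept n))
    (δ : ℝ) : Prop :=
  ∀ c ∈ 𝒞, 1 - δ ≤ L.outputProb c c

/-- The `k`-Fourier-sparse Boolean functions on `n` bits of Fourier dimension at most `r`. -/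
def sparseClass (n k r : ℕ) : Set (Concept n) :=
  {c | IsFourierSparse k c.toReal ∧ fourierDim c.toReal ≤ r}

end QLearn

end

namespace QLearn

open Matrix Finset
open scoped ComplexOrder

/-! The learner is nonadaptive. It Fourier samples about `2kr` examples, measures about `64kr log k`
in the computational basis, and outputs any `k`-sparse concept whose Fourier span lies in the span
of the samples and which agrees with all labels.

Everything rests on one inequality: a function with `m` nonzero Fourier coefficients that reaches
absolute value 1 has squared Fourier weight at least `1/m` (`one_le_mul_sum_fourierCoeff_sq`).
Applied to a derivative of the target `c`, it shows that a Fourier sample escapes a given hyperplane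
not containing the Fourier span `W` with probability at least `1/(2k)`; a union bound over the at
most `2^r` functionals on `W` shows that the samples span `W`. Applied to `(c - d)/2`, it shows that
distinct sparse concepts are at distance at least `1/(2k)`.

A union bound over all sparse concepts on `W` would need too many labels, so they are grouped by
distance from `c`. At distance about `a/(2k)` the function `(c - d)/2` has Fourier `ℓ¹` norm at most
`√(2a)`, so random sampling of characters (Maurey's argument) determines `d` by `O(a log k)` signed
characters, each costing `r + 1` bits (`card_concepts_at_scale_le`). The count grows like `2^O(ar
log k)`, while the chance that such a `d` fits every label decays at a matching rate, and the scales
sum geometrically. -/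

lemma neg_one_pow_val_add (a b : ZMod 2) :
    (-1 : ℝ) ^ (a + b).val = (-1) ^ a.val * (-1) ^ b.val := by
  have h : ∀ a b : ZMod 2, (-1 : ℤ) ^ (a + b).val = (-1) ^ a.val * (-1) ^ b.val := by decide
  exact_mod_cast h a b

lemma neg_one_pow_val_of_ne_zero {a : ZMod 2} (ha : a ≠ 0) : (-1 : ℝ) ^ a.val = -1 := by
  have h : ∀ a : ZMod 2, a ≠ 0 → (-1 : ℤ) ^ a.val = -1 := by decide
  exact_mod_cast h a ha

/-! ### Fourier analysis of sparse functions on the cube. -/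

section Fourier

variable {n : ℕ}

lemma character_add_right (S x y : Cube n) :
    character S (x + y) = character S x * character S y := by
  simp only [character, dotProduct_add, neg_one_pow_val_add]

lemma character_comm (S x : Cube n) : character S x = character x S := by
  simp only [character, dotProduct_comm]

lemma character_mul_self (S x : Cube n) : character S x * character S x = 1 := by
  simp only [character, ← mul_pow]
  simp

lemma character_of_dotProduct_eq_zero {S x : Cube n} (h : S ⬝ᵥ x = 0) : character S x = 1 := by
  simp [character, h]

lemma character_of_dotProduct_ne_zero {S x : Cube n} (h : S ⬝ᵥ x ≠ 0) : character S x = -1 :=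
  neg_one_pow_val_of_ne_zero h

lemma abs_character (S x : Cube n) : |character S x| = 1 := by
  simp [character]

lemma sum_character (S : Cube n) : ∑ x, character S x = if S = 0 then (2 : ℝ) ^ n else 0 := by
  split_ifs with h
  · subst h
    simp [character, ZMod.card]
  · obtain ⟨i, hi⟩ := Function.ne_iff.mp h
    have h1 : character S (Pi.single i 1) = -1 := by
      apply character_of_dotProduct_ne_zero
      simpa using hi
    have h2 : ∑ x, character S (x + Pi.single i 1) = ∑ x, character S x :=
      Fintype.sum_equiv (Equiv.addRight (Pi.single i 1)) _ _ (fun _ => rfl)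
    simp only [character_add_right, h1, ← Finset.sum_mul] at h2
    linarith

lemma cube_add_self (x : Cube n) : x + x = 0 := by
  ext i
  exact CharTwo.add_self_eq_zero _

lemma cube_add_eq_zero {x y : Cube n} : x + y = 0 ↔ x = y := by
  constructor
  · intro h
    calc x = x + (y + y) := by rw [cube_add_self, add_zero]
      _ = y := by rw [← add_assoc, h, zero_add]
  · rintro rfl
    exact cube_add_self x

lemma sum_character_mul_character (x y : Cube n) :
    ∑ S, character S x * character S y = if x = y then (2 : ℝ) ^ n else 0 := by
  simp only [← character_add_right, character_comm _ (x + y), sum_character, cube_add_eq_zero]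

/-- Fourier inversion. -/
lemma sum_fourierCoeff_mul_character (f : Cube n → ℝ) (x : Cube n) :
    ∑ S, fourierCoeff f S * character S x = f x := by
  have h : ∀ S, fourierCoeff f S * character S x
      = ∑ z, f z * (character S z * character S x) / 2 ^ n := by
    intro S
    simp only [fourierCoeff, Finset.sum_div, Finset.sum_mul]
    exact Finset.sum_congr rfl fun z _ => by ring
  simp only [h]
  rw [Finset.sum_comm]
  simp only [← Finset.sum_div, ← Finset.mul_sum, sum_character_mul_character]
  simp

/-- Parseval's identity. -/
lemma sum_fourierCoeff_sq (f : Cube n → ℝ) :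
    ∑ S, fourierCoeff f S ^ 2 = (∑ x, f x ^ 2) / 2 ^ n := by
  have h : ∀ S, fourierCoeff f S ^ 2 = ∑ x, f x * (fourierCoeff f S * character S x) / 2 ^ n := by
    intro S
    rw [sq]
    nth_rewrite 2 [fourierCoeff]
    simp only [Finset.sum_div, Finset.mul_sum]
    exact Finset.sum_congr rfl fun z _ => by ring
  simp only [h]
  rw [Finset.sum_comm]
  simp only [← Finset.sum_div, ← Finset.mul_sum, sum_fourierCoeff_mul_character, sq]

/-- Cauchy–Schwarz on the Fourier support. -/
lemma sum_abs_fourierCoeff_sq_le {f : Cube n → ℝ} {m : ℕ} (hf : IsFourierSparse m f) :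
    (∑ S, |fourierCoeff f S|) ^ 2 ≤ m * ∑ S, fourierCoeff f S ^ 2 := by
  classical
  set K : Finset (Cube n) := univ.filter fun S => fourierCoeff f S ≠ 0 with hK
  have hcard : (#K : ℝ) ≤ m := by
    have : fourierSupport f = (K : Set (Cube n)) := by ext; simp [hK, fourierSupport]
    rw [IsFourierSparse, this, Set.ncard_coe_finset] at hf
    exact_mod_cast hf
  have h1 : ∑ S, |fourierCoeff f S| = ∑ S ∈ K, |fourierCoeff f S| := by
    symm
    apply Finset.sum_subset (Finset.subset_univ _)
    intro S _ hS
    simpa [hK] using hS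
  have h2 : ∑ S ∈ K, |fourierCoeff f S| ^ 2 ≤ ∑ S, fourierCoeff f S ^ 2 := by
    simp only [sq_abs]
    exact Finset.sum_le_univ_sum_of_nonneg fun _ => sq_nonneg _
  rw [h1]
  calc _ ≤ (#K : ℝ) * ∑ S ∈ K, |fourierCoeff f S| ^ 2 := sq_sum_le_card_mul_sum_sq
    _ ≤ m * ∑ S, fourierCoeff f S ^ 2 := by gcongr

lemma abs_le_sum_abs_fourierCoeff (f : Cube n → ℝ) (x : Cube n) :
    |f x| ≤ ∑ S, |fourierCoeff f S| := by
  rw [← sum_fourierCoeff_mul_character f x]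
  refine (Finset.abs_sum_le_sum_abs _ _).trans_eq ?_
  simp [abs_mul, abs_character]

/-- A sparse function that reaches absolute value one somewhere has large Fourier weight. -/
lemma one_le_mul_sum_fourierCoeff_sq {f : Cube n → ℝ} {m : ℕ} (hf : IsFourierSparse m f)
    {x : Cube n} (hx : 1 ≤ |f x|) : 1 ≤ m * ∑ S, fourierCoeff f S ^ 2 := by
  have h := hx.trans (abs_le_sum_abs_fourierCoeff f x)
  calc (1 : ℝ) ≤ (∑ S, |fourierCoeff f S|) ^ 2 := one_le_pow₀ h
    _ ≤ _ := sum_abs_fourierCoeff_sq_le hf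

lemma fourierCoeff_half_sub (f g : Cube n → ℝ) (S : Cube n) :
    fourierCoeff (fun x => (f x - g x) / 2) S = (fourierCoeff f S - fourierCoeff g S) / 2 := by
  have h : ∑ x, (f x - g x) / 2 * character S x
      = (∑ x, f x * character S x - ∑ x, g x * character S x) / 2 := by
    rw [← Finset.sum_sub_distrib, Finset.sum_div]
    exact Finset.sum_congr rfl fun z _ => by ring
  simp only [fourierCoeff, h]
  ring

lemma fourierCoeff_shift (f : Cube n → ℝ) (y S : Cube n) :
    fourierCoeff (fun x => f (x + y)) S = fourierCoeff f S * character S y := by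
  simp only [fourierCoeff]
  rw [div_mul_eq_mul_div, Finset.sum_mul]
  congr 1
  refine Fintype.sum_equiv (Equiv.addRight y) _ _ fun x => ?_
  simp only [Equiv.coe_addRight, character_add_right]
  linear_combination (-1 : ℝ) * (f (x + y) * character S x) * character_mul_self S y

lemma IsFourierSparse.half_sub {f g : Cube n → ℝ} {k l : ℕ} (hf : IsFourierSparse k f)
    (hg : IsFourierSparse l g) : IsFourierSparse (k + l) (fun x => (f x - g x) / 2) := by
  have hsub : fourierSupport (fun x => (f x - g x) / 2) ⊆ fourierSupport f ∪ fourierSupport g := by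
    intro S hS
    by_contra h
    simp only [fourierSupport, Set.mem_union, Set.mem_ofPred_eq, not_or, not_not] at h
    exact hS (by rw [fourierCoeff_half_sub, h.1, h.2]; simp)
  calc _ ≤ (fourierSupport f ∪ fourierSupport g).ncard := Set.ncard_le_ncard hsub (Set.toFinite _)
    _ ≤ _ := (Set.ncard_union_le _ _).trans (add_le_add hf hg)

lemma Concept.toReal_eq_or (c : Concept n) (x : Cube n) : c.toReal x = 1 ∨ c.toReal x = -1 := by
  rcases Int.units_eq_one_or (c x) with h | h <;> simp [Concept.toReal, h]

lemma Concept.toReal_inj {c d : Concept n} {x : Cube n} : c.toReal x = d.toReal x ↔ c x = d x := by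
  simp [Concept.toReal, Units.ext_iff]

/-- Half the difference of two `±1` values is `0` where they agree and `±1` elsewhere. -/
lemma half_sub_eq_of_ne {a b : ℝ} (ha : a = 1 ∨ a = -1) (hb : b = 1 ∨ b = -1) (h : a ≠ b) :
    (a - b) / 2 = a := by
  rcases ha with rfl | rfl <;> rcases hb with rfl | rfl <;> norm_num at *

lemma abs_eq_one_of_eq_or {a : ℝ} (ha : a = 1 ∨ a = -1) : |a| = 1 := by
  rcases ha with rfl | rfl <;> simp

/-- The Fourier weight of a sparse Boolean function outside a hyperplane that does not contain
its Fourier support. -/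
lemma one_le_mul_fourierWeight {c : Concept n} {k : ℕ} (hc : IsFourierSparse k c.toReal)
    {y : Cube n} (hy : ∃ S ∈ fourierSpan c.toReal, S ⬝ᵥ y ≠ 0) :
    1 ≤ k * ∑ S with S ⬝ᵥ y ≠ 0, fourierCoeff c.toReal S ^ 2 := by
  classical
  -- This derivative keeps the coefficients with `S ⬝ᵥ y ≠ 0` and kills the others. It is therefore
  -- still `k`-sparse, without the doubling that a general difference would incur.
  set g : Cube n → ℝ := fun x => (c.toReal x - c.toReal (x + y)) / 2 with hg
  have hcoeff : ∀ S, fourierCoeff g S = if S ⬝ᵥ y ≠ 0 then fourierCoeff c.toReal S else 0 := by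
    intro S
    rw [hg, fourierCoeff_half_sub c.toReal (fun x => c.toReal (x + y)), fourierCoeff_shift]
    split_ifs with h
    · rw [character_of_dotProduct_ne_zero h]; ring
    · rw [character_of_dotProduct_eq_zero (not_not.mp h)]; ring
  have hsparse : IsFourierSparse k g := by
    refine (Set.ncard_le_ncard (fun S hS => ?_) (Set.toFinite _)).trans hc
    simp only [fourierSupport, Set.mem_ofPred_eq, hcoeff] at hS ⊢
    by_contra h
    simp [h] at hS
  have hsum : ∑ S, fourierCoeff g S ^ 2 = ∑ S with S ⬝ᵥ y ≠ 0, fourierCoeff c.toReal S ^ 2 := by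
    rw [Finset.sum_filter]
    refine Finset.sum_congr rfl fun S _ => ?_
    rw [hcoeff]
    split_ifs <;> simp
  obtain ⟨S, hS, hSy⟩ : ∃ S ∈ fourierSupport c.toReal, S ⬝ᵥ y ≠ 0 := by
    by_contra! h
    obtain ⟨S, hS, hSy⟩ := hy
    refine hSy ?_
    clear hSy
    induction hS using Submodule.span_induction with
    | mem x hx => exact h x hx
    | zero => simp
    | add a b _ _ ha hb => rw [add_dotProduct, ha, hb, add_zero]
    | smul t a _ ha => rw [smul_dotProduct, ha, smul_zero]
  obtain ⟨x, hx⟩ : ∃ x, c.toReal x ≠ c.toReal (x + y) := by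
    by_contra! h
    have : fourierCoeff g S = 0 := by simp [hg, fourierCoeff, ← h]
    rw [hcoeff, if_pos hSy] at this
    exact hS this
  rw [← hsum]
  refine one_le_mul_sum_fourierCoeff_sq hsparse (x := x) (le_of_eq ?_)
  simp only [hg]
  rw [half_sub_eq_of_ne (c.toReal_eq_or x) (c.toReal_eq_or _) hx,
    abs_eq_one_of_eq_or (c.toReal_eq_or x)]

/-- The fraction of inputs on which two concepts disagree. -/
noncomputable def Concept.dist (c d : Concept n) : ℝ := #{x | c x ≠ d x} / 2 ^ n

lemma card_cube : Fintype.card (Cube n) = 2 ^ n := by simp [ZMod.card]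

/-- Parseval: the square of `(c - d)/2` is the indicator of disagreement. -/
lemma Concept.sum_fourierCoeff_half_sub_sq (c d : Concept n) :
    ∑ S, fourierCoeff (fun x => (c.toReal x - d.toReal x) / 2) S ^ 2 = c.dist d := by
  rw [sum_fourierCoeff_sq, Concept.dist]
  congr 1
  rw [Finset.card_filter]
  push_cast
  refine Finset.sum_congr rfl fun x _ => ?_
  split_ifs with h
  · rw [half_sub_eq_of_ne (c.toReal_eq_or x) (d.toReal_eq_or x)
      (fun h' => h (Concept.toReal_inj.mp h')), ← sq_abs, abs_eq_one_of_eq_or (c.toReal_eq_or x)]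
    simp
  · rw [Concept.toReal_inj.mpr (not_not.mp h)]; simp

/-- Distinct sparse concepts are far apart. -/
lemma one_le_mul_dist {c d : Concept n} {k : ℕ} (hc : IsFourierSparse k c.toReal)
    (hd : IsFourierSparse k d.toReal) (hne : c ≠ d) : 1 ≤ 2 * k * c.dist d := by
  obtain ⟨x, hx⟩ := Function.ne_iff.mp hne
  have := one_le_mul_sum_fourierCoeff_sq (hc.half_sub hd) (x := x) (by
    rw [half_sub_eq_of_ne (c.toReal_eq_or x) (d.toReal_eq_or x)
      (fun h' => hx (Concept.toReal_inj.mp h')), abs_eq_one_of_eq_or (c.toReal_eq_or x)])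
  rw [c.sum_fourierCoeff_half_sub_sq d] at this
  push_cast at this
  linarith

end Fourier

/-! ### Product measurements and their outcome probabilities. -/

section Measurement

variable {n T : ℕ}

lemma sum_pi_prod {ι α R : Type*} [Fintype ι] [DecidableEq ι] [Fintype α] [CommSemiring R]
    (p : ι → α → R) : ∑ o : ι → α, ∏ i, p i (o i) = ∏ i, ∑ a, p i a := by
  rw [Finset.prod_univ_sum, Fintype.piFinset_univ]

/-- The tensor product of the matrices `u i`. -/
def tensorMatrix {α : Type*} (u : Fin T → Matrix α α ℂ) : Matrix (Fin T → α) (Fin T → α) ℂ :=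
  fun o s => ∏ i, u i (o i) (s i)

lemma tensorMatrix_conjTranspose_mul_self {α : Type*} [Fintype α] [DecidableEq α]
    {u : Fin T → Matrix α α ℂ} (hu : ∀ i, (u i)ᴴ * u i = 1) :
    (tensorMatrix u)ᴴ * tensorMatrix u = 1 := by
  ext s s'
  simp only [mul_apply, conjTranspose_apply, tensorMatrix, star_prod, ← Finset.prod_mul_distrib]
  rw [sum_pi_prod fun i a => star (u i a (s i)) * u i a (s' i)]
  have h : ∀ i, ∑ a, star (u i a (s i)) * u i a (s' i) = if s i = s' i then 1 else 0 := by
    intro i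
    have := congrFun (congrFun (hu i) (s i)) (s' i)
    simpa only [mul_apply, conjTranspose_apply, one_apply] using this
  simp only [h, one_apply, Finset.prod_ite_zero, Finset.prod_const_one, funext_iff,
    Finset.mem_univ, true_implies]

lemma tensorMatrix_mulVec_quantumExamples (u : Fin T → Matrix (ExampleBasis n) (ExampleBasis n) ℂ)
    (c : Concept n) (o : Fin T → ExampleBasis n) :
    (tensorMatrix u *ᵥ quantumExamples c T) o = ∏ i, (u i *ᵥ quantumExample c) (o i) := by
  simp only [mulVec, dotProduct, tensorMatrix, quantumExamples, ← Finset.prod_mul_distrib]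
  exact sum_pi_prod fun i a => u i (o i) a * quantumExample c a

/-- The learner that measures the `i`-th example in the orthonormal basis given by the unitary
`u i` and outputs the value of `g` at the outcomes. -/
def measureLearner (u : Fin T → Matrix (ExampleBasis n) (ExampleBasis n) ℂ)
    (hu : ∀ i, (u i)ᴴ * u i = 1) (g : (Fin T → ExampleBasis n) → Concept n) :
    QuantumLearner n T where
  effect h := (tensorMatrix u)ᴴ * diagonal (fun o => if g o = h then 1 else 0) * tensorMatrix u
  posSemidef h := by
    refine PosSemidef.conjTranspose_mul_mul_same (PosSemidef.diagonal fun o => ?_) _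
    dsimp only [Pi.zero_apply]
    split_ifs <;> simp
  sum_effect := by
    rw [← Finset.sum_mul, ← Finset.mul_sum]
    have : ∑ h, diagonal (fun o => if g o = h then (1 : ℂ) else 0) = 1 := by
      ext o o'
      rw [Matrix.sum_apply]
      by_cases h : o = o'
      · subst h; simp
      · simp [h]
    rw [this, mul_one, tensorMatrix_conjTranspose_mul_self hu]

/-- Both the measurement and the state are tensor products, so the outcomes are independent; from
here on the analysis is classical probability. -/
lemma outputProb_measureLearner (u : Fin T → Matrix (ExampleBasis n) (ExampleBasis n) ℂ)
    (hu : ∀ i, (u i)ᴴ * u i = 1) (g : (Fin T → ExampleBasis n) → Concept n) (c h : Concept n) :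
    (measureLearner u hu g).outputProb c h
      = ∑ o with g o = h, ∏ i, ‖(u i *ᵥ quantumExample c) (o i)‖ ^ 2 := by
  simp only [QuantumLearner.outputProb, measureLearner]
  rw [← mulVec_mulVec, ← mulVec_mulVec, dotProduct_mulVec, ← star_mulVec]
  simp only [dotProduct, mulVec_diagonal, Pi.star_apply, tensorMatrix_mulVec_quantumExamples]
  rw [Complex.re_sum, Finset.sum_filter]
  refine Finset.sum_congr rfl fun o _ => ?_
  split_ifs
  · rw [one_mul, Finset.prod_pow, ← norm_prod, ← Complex.normSq_eq_norm_sq, Complex.star_def,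
      ← Complex.normSq_eq_conj_mul_self, Complex.ofReal_re]
  · simp

end Measurement

/-! ### Product distributions and a Chernoff-type bound. -/

section Product

variable {ι α : Type*} [Fintype ι] [DecidableEq ι] [Fintype α]

lemma sum_filter_prod (p : ι → α → ℝ) (B : ι → α → Prop) [∀ i, DecidablePred (B i)] :
    ∑ o : ι → α with (∀ i, B i (o i)), ∏ i, p i (o i) = ∏ i, ∑ a with B i a, p i a := by
  rw [Finset.prod_univ_sum]
  apply Finset.sum_congr _ fun _ _ => rfl
  ext o
  simp

/-- In a product of two powers of distributions, the probability that the outcomes of the first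
distribution all lie in `B`. -/
lemma sum_filter_prod_left {m l : ℕ} {p q : α → ℝ} (hq : ∑ a, q a = 1) (B : α → Prop)
    [DecidablePred B] :
    ∑ o : Fin (m + l) → α with (∀ i, B (o (Fin.castAdd l i))),
      (∏ i, p (o (Fin.castAdd l i))) * ∏ j, q (o (Fin.natAdd m j)) = (∑ a with B a, p a) ^ m := by
  classical
  have h := sum_filter_prod (ι := Fin (m + l)) (Fin.addCases (fun _ => p) (fun _ => q))
    (Fin.addCases (fun _ => B) (fun _ _ => True))
  simpa [Fin.prod_univ_add, Fin.forall_fin_add, hq] using h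

/-- In a product of two powers of distributions, the probability that the outcomes of the second
distribution all lie in `B`. -/
lemma sum_filter_prod_right {m l : ℕ} {p q : α → ℝ} (hp : ∑ a, p a = 1) (B : α → Prop)
    [DecidablePred B] :
    ∑ o : Fin (m + l) → α with (∀ j, B (o (Fin.natAdd m j))),
      (∏ i, p (o (Fin.castAdd l i))) * ∏ j, q (o (Fin.natAdd m j)) = (∑ a with B a, q a) ^ l := by
  classical
  have h := sum_filter_prod (ι := Fin (m + l)) (Fin.addCases (fun _ => p) (fun _ => q))
    (Fin.addCases (fun _ _ => True) (fun _ => B))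
  simpa [Fin.prod_univ_add, Fin.forall_fin_add, hp] using h

lemma sum_pow_prod {t : ℕ} (p : α → ℝ) : ∑ o : Fin t → α, ∏ i, p (o i) = (∑ a, p a) ^ t := by
  rw [sum_pi_prod fun _ => p]
  simp

/-- An exponential tail bound for sums of independent bounded variables. -/
lemma sum_filter_tail_le {t : ℕ} {w X : α → ℝ} (hw : ∀ a, 0 ≤ w a) (hw1 : ∑ a, w a = 1)
    (hX : ∀ a, |X a| ≤ 1) {y : ℝ} (hy0 : 0 ≤ y) (hy1 : y ≤ 1)
    (B : (Fin t → α) → Prop) [DecidablePred B]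
    (hB : ∀ o, B o → t * (∑ a, w a * X a) + t * (2 * y) ≤ ∑ i, X (o i)) :
    ∑ o with B o, ∏ i, w (o i) ≤ Real.exp (-(t * y ^ 2)) := by
  set μ := ∑ a, w a * X a with hμ
  -- Uses `e^z ≤ 1 + z + z²` for `|z| ≤ 1`. Against a deviation of `2y` per sample, Markov's
  -- inequality then leaves the exponent `y² - 2y² = -y²`.
  have hmgf : ∑ a, w a * Real.exp (y * X a) ≤ Real.exp (y * μ + y ^ 2) := by
    have h1 : ∀ a, Real.exp (y * X a) ≤ 1 + y * X a + y ^ 2 := by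
      intro a
      have habs : |y * X a| ≤ y := by
        rw [abs_mul, abs_of_nonneg hy0]
        exact mul_le_of_le_one_right hy0 (hX a)
      have h2 := Real.abs_exp_sub_one_sub_id_le (habs.trans hy1)
      have h3 : (y * X a) ^ 2 ≤ y ^ 2 := by
        rw [← sq_abs]
        gcongr
      linarith [le_abs_self (Real.exp (y * X a) - 1 - y * X a)]
    calc ∑ a, w a * Real.exp (y * X a) ≤ ∑ a, w a * (1 + y * X a + y ^ 2) :=
          Finset.sum_le_sum fun a _ => mul_le_mul_of_nonneg_left (h1 a) (hw a)
      _ = (1 + y ^ 2) * ∑ a, w a + y * μ := by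
          rw [hμ, Finset.mul_sum, Finset.mul_sum, ← Finset.sum_add_distrib]
          exact Finset.sum_congr rfl fun a _ => by ring
      _ = y * μ + y ^ 2 + 1 := by rw [hw1]; ring
      _ ≤ _ := Real.add_one_le_exp _
  have hprod : ∀ o : Fin t → α, ∏ i, w (o i) * Real.exp (y * X (o i))
      = (∏ i, w (o i)) * Real.exp (y * ∑ i, X (o i)) := by
    intro o
    rw [Finset.prod_mul_distrib, ← Real.exp_sum, Finset.mul_sum]
  have hnn : ∀ o : Fin t → α, 0 ≤ ∏ i, w (o i) := fun o => Finset.prod_nonneg fun i _ => hw _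
  calc ∑ o with B o, ∏ i, w (o i)
      ≤ ∑ o with B o, Real.exp (-(y * (t * μ + t * (2 * y)))) *
          ∏ i, w (o i) * Real.exp (y * X (o i)) := by
        refine Finset.sum_le_sum fun o ho => ?_
        rw [hprod, mul_left_comm, ← Real.exp_add]
        refine le_mul_of_one_le_right (hnn o) (Real.one_le_exp ?_)
        have := mul_le_mul_of_nonneg_left (hB o (Finset.mem_filter.mp ho).2) hy0
        linarith
    _ ≤ ∑ o : Fin t → α, Real.exp (-(y * (t * μ + t * (2 * y)))) *
          ∏ i, w (o i) * Real.exp (y * X (o i)) := by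
        refine Finset.sum_le_univ_sum_of_nonneg fun o => ?_
        rw [hprod]
        exact mul_nonneg (Real.exp_nonneg _) (mul_nonneg (hnn o) (Real.exp_nonneg _))
    _ = Real.exp (-(y * (t * μ + t * (2 * y)))) * (∑ a, w a * Real.exp (y * X a)) ^ t := by
        rw [← Finset.mul_sum, sum_pow_prod fun a => w a * Real.exp (y * X a)]
    _ ≤ Real.exp (-(y * (t * μ + t * (2 * y)))) * Real.exp (y * μ + y ^ 2) ^ t := by
        gcongr
        exact Finset.sum_nonneg fun a _ => mul_nonneg (hw a) (Real.exp_nonneg _)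
    _ = Real.exp (-(t * y ^ 2)) := by
        rw [← Real.exp_nat_mul, ← Real.exp_add]
        congr 1
        ring

end Product

/-! ### Fourier sampling and recovery of the Fourier span. -/

section FourierSampling

variable {n : ℕ}

/-- The characters of the label qubit. -/
noncomputable def labelCharacter (a b : ℤˣ) : ℝ := if a = 1 then 1 else ((b : ℤ) : ℝ)

/-- The Hadamard transform of the `n + 1` qubits of one example. -/
noncomputable def fourierMatrix (n : ℕ) : Matrix (ExampleBasis n) (ExampleBasis n) ℂ := fun p q =>
  ((character p.1 q.1 * labelCharacter p.2 q.2 / Real.sqrt (2 ^ (n + 1)) : ℝ) : ℂ)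

lemma sum_intUnits (f : ℤˣ → ℝ) : ∑ a, f a = f 1 + f (-1) := by
  rw [UnitsInt.univ, Finset.sum_pair (by decide)]

lemma sum_labelCharacter_mul (b b' : ℤˣ) :
    ∑ a, labelCharacter a b * labelCharacter a b' = if b = b' then 2 else 0 := by
  rw [sum_intUnits]
  rcases Int.units_eq_one_or b with rfl | rfl <;> rcases Int.units_eq_one_or b' with rfl | rfl <;>
    norm_num [labelCharacter]

lemma fourierMatrix_conjTranspose_mul_self : (fourierMatrix n)ᴴ * fourierMatrix n = 1 := by
  ext q q'
  have h : ∀ p : ExampleBasis n, star (fourierMatrix n p q) * fourierMatrix n p q' =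
      (((character p.1 q.1 * character p.1 q'.1) * (labelCharacter p.2 q.2 * labelCharacter p.2 q'.2)
        / 2 ^ (n + 1) : ℝ) : ℂ) := by
    intro p
    simp only [fourierMatrix, Complex.star_def, Complex.conj_ofReal]
    rw [← Complex.ofReal_mul, div_mul_div_comm, Real.mul_self_sqrt (by positivity)]
    congr 2
    ring
  simp only [mul_apply, conjTranspose_apply, h]
  rw [← Complex.ofReal_sum, ← Finset.sum_div, Fintype.sum_prod_type]
  simp only [← Finset.mul_sum, ← Finset.sum_mul, sum_labelCharacter_mul,
    sum_character_mul_character, one_apply, Prod.ext_iff]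
  by_cases h1 : q.1 = q'.1 <;> by_cases h2 : q.2 = q'.2 <;> simp [h1, h2, pow_succ]

lemma fourierMatrix_mulVec (c : Concept n) (S : Cube n) (a : ℤˣ) :
    (fourierMatrix n *ᵥ quantumExample c) (S, a)
      = (((∑ x, character S x * labelCharacter a (c x)) / 2 ^ n / Real.sqrt 2 : ℝ) : ℂ) := by
  have hsq : Real.sqrt (2 ^ (n + 1)) * Real.sqrt (2 ^ n) = 2 ^ n * Real.sqrt 2 := by
    rw [pow_succ, Real.sqrt_mul (by positivity), mul_right_comm, Real.mul_self_sqrt (by positivity)]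
  simp only [mulVec, dotProduct, quantumExample, Fintype.sum_prod_type, mul_ite, mul_zero,
    Finset.sum_ite_eq', Finset.mem_univ, if_true, fourierMatrix]
  simp only [← Complex.ofReal_mul]
  rw [← Complex.ofReal_sum, div_div, ← hsq, Finset.sum_div]
  congr 1
  exact Finset.sum_congr rfl fun x _ => by rw [div_mul_div_comm, mul_one]

/-- The outcome distribution of Fourier sampling. -/
noncomputable def fourierProb (c : Concept n) (o : ExampleBasis n) : ℝ :=
  if o.2 = 1 then (if o.1 = 0 then 1 / 2 else 0) else fourierCoeff c.toReal o.1 ^ 2 / 2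

/-- Label outcome `1` selects the trivial label character: the target drops out, and only `S = 0`
survives. This wastes half of the samples; the other half follow the squared Fourier coefficients.
-/
lemma norm_sq_fourierMatrix_mulVec (c : Concept n) (o : ExampleBasis n) :
    ‖(fourierMatrix n *ᵥ quantumExample c) o‖ ^ 2 = fourierProb c o := by
  obtain ⟨S, a⟩ := o
  rw [fourierMatrix_mulVec, Complex.norm_real, Real.norm_eq_abs, sq_abs, div_pow,
    Real.sq_sqrt (by norm_num)]
  rcases Int.units_eq_one_or a with rfl | rfl
  · simp only [labelCharacter, fourierProb, if_true, mul_one, sum_character]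
    split_ifs <;> simp
  · have h : ((-1 : ℤˣ) = 1) = False := by simp
    simp only [labelCharacter, fourierProb, h, if_false, fourierCoeff, Concept.toReal, mul_comm]

/-- The outcome distribution of a measurement in the computational basis. -/
noncomputable def sampleProb (c : Concept n) (o : ExampleBasis n) : ℝ :=
  if o.2 = c o.1 then 1 / 2 ^ n else 0

lemma norm_sq_one_mulVec (c : Concept n) (o : ExampleBasis n) :
    ‖((1 : Matrix (ExampleBasis n) (ExampleBasis n) ℂ) *ᵥ quantumExample c) o‖ ^ 2
      = sampleProb c o := by
  rw [one_mulVec, quantumExample, sampleProb]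
  split_ifs
  · rw [Complex.norm_real, Real.norm_eq_abs, sq_abs, div_pow, Real.sq_sqrt (by positivity), one_pow]
  · simp

lemma fourierProb_nonneg (c : Concept n) (o : ExampleBasis n) : 0 ≤ fourierProb c o := by
  rw [← norm_sq_fourierMatrix_mulVec]
  positivity

lemma sampleProb_nonneg (c : Concept n) (o : ExampleBasis n) : 0 ≤ sampleProb c o := by
  rw [sampleProb]
  positivity

lemma sum_fourierProb (c : Concept n) : ∑ o, fourierProb c o = 1 := by
  have h : ∑ S, fourierCoeff c.toReal S ^ 2 = 1 := by
    rw [sum_fourierCoeff_sq]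
    have : ∀ x, c.toReal x ^ 2 = 1 := fun x => by
      rw [← sq_abs, abs_eq_one_of_eq_or (c.toReal_eq_or x), one_pow]
    simp [this, ZMod.card]
  rw [Fintype.sum_prod_type_right, sum_intUnits]
  simp [fourierProb, ← Finset.sum_div, h]
  norm_num

lemma sum_sampleProb_filter_agree (c d : Concept n) :
    ∑ o with o.2 = d o.1, sampleProb c o = 1 - c.dist d := by
  have h : ∀ x, ∑ b, (if b = d x then (if b = c x then (1 : ℝ) / 2 ^ n else 0) else 0)
      = (1 - if c x ≠ d x then (1 : ℝ) else 0) / 2 ^ n := by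
    intro x
    rw [Finset.sum_ite_eq', if_pos (Finset.mem_univ _)]
    by_cases hx : c x = d x <;> simp [hx, eq_comm]
  rw [Finset.sum_filter, Fintype.sum_prod_type]
  simp only [sampleProb, h]
  rw [← Finset.sum_div, Finset.sum_sub_distrib, sub_div, Concept.dist, Finset.card_filter]
  simp [ZMod.card]

lemma sum_sampleProb (c : Concept n) : ∑ o, sampleProb c o = 1 := by
  have h := sum_sampleProb_filter_agree c c
  rw [Finset.sum_filter] at h
  have h2 : c.dist c = 0 := by simp [Concept.dist]
  rw [h2, sub_zero] at h
  rw [← h]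
  refine Finset.sum_congr rfl fun o _ => ?_
  simp only [sampleProb]
  split_ifs <;> rfl

/-- The Fourier weight off the hyperplane is at least `1/k`, halved because a wasted sample always
yields `0`. -/
lemma sum_fourierProb_filter_le {c : Concept n} {k : ℕ} (hk : 0 < k)
    (hc : IsFourierSparse k c.toReal) {y : Cube n} (hy : ∃ S ∈ fourierSpan c.toReal, S ⬝ᵥ y ≠ 0) :
    ∑ o with o.1 ⬝ᵥ y = 0, fourierProb c o ≤ 1 - 1 / (2 * k) := by
  have h1 := one_le_mul_fourierWeight hc hy
  have h2 : ∑ o with o.1 ⬝ᵥ y ≠ 0, fourierProb c o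
      = (∑ S with S ⬝ᵥ y ≠ 0, fourierCoeff c.toReal S ^ 2) / 2 := by
    rw [Finset.sum_filter, Finset.sum_filter, Fintype.sum_prod_type_right, sum_intUnits,
      Finset.sum_div]
    have h3 : ∑ S : Cube n, (if S ⬝ᵥ y ≠ 0 then fourierProb c (S, 1) else 0) = 0 := by
      refine Finset.sum_eq_zero fun S _ => ?_
      by_cases hS : S = 0 <;> simp [fourierProb, hS]
    rw [h3, zero_add]
    refine Finset.sum_congr rfl fun S _ => ?_
    split_ifs <;> simp [fourierProb]
  have h4 := Finset.sum_filter_add_sum_filter_not univ (fun o : ExampleBasis n => o.1 ⬝ᵥ y = 0)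
    (fourierProb c)
  rw [sum_fourierProb, h2] at h4
  have h5 : (1 : ℝ) / (2 * k) ≤ (∑ S with S ⬝ᵥ y ≠ 0, fourierCoeff c.toReal S ^ 2) / 2 := by
    rw [div_le_div_iff₀ (by positivity) (by norm_num)]
    linarith
  linarith

/-- A wasted sample is harmless, since `0` lies in every subspace. -/
lemma mem_fourierSpan_of_fourierProb_ne_zero {c : Concept n} {o : ExampleBasis n}
    (h : fourierProb c o ≠ 0) : o.1 ∈ fourierSpan c.toReal := by
  by_cases h0 : o.1 = 0
  · rw [h0]
    exact zero_mem _
  · refine Submodule.subset_span fun h1 => h ?_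
    simp [fourierProb, h0, h1]

/-- Few linear functionals detect all proper subspaces of a subspace of the cube. -/
lemma exists_separating_finset (W : Submodule (ZMod 2) (Cube n)) :
    ∃ Y : Finset (Cube n), #Y ≤ 2 ^ Module.finrank (ZMod 2) W ∧
      (∀ y ∈ Y, ∃ S ∈ W, S ⬝ᵥ y ≠ 0) ∧
      ∀ U ≤ W, U ≠ W → ∃ y ∈ Y, ∀ S ∈ U, S ⬝ᵥ y = 0 := by
  classical
  have hrep : ∀ f : Cube n →ₗ[ZMod 2] ZMod 2, ∃ y : Cube n, ∀ S, f S = S ⬝ᵥ y := fun f =>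
    ⟨fun i => f (Pi.single i 1), fun S => by
      rw [LinearMap.pi_apply_eq_sum_univ f S]
      simp only [dotProduct, smul_eq_mul]
      refine Finset.sum_congr rfl fun i _ => ?_
      congr 2
      ext j
      simp [Pi.single_apply, eq_comm]⟩
  have hrepW : ∀ φ : Module.Dual (ZMod 2) W, ∃ y : Cube n, ∀ S : W, φ S = (S : Cube n) ⬝ᵥ y := by
    intro φ
    obtain ⟨f, hf⟩ := LinearMap.exists_extend φ
    obtain ⟨y, hy⟩ := hrep f
    exact ⟨y, fun S => by rw [← hy, ← hf]; rfl⟩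
  choose y hy using hrepW
  have : Finite (Module.Dual (ZMod 2) W) := Module.finite_of_finite (ZMod 2)
  have := Fintype.ofFinite (Module.Dual (ZMod 2) W)
  -- One representative for each nonzero functional on `W`: a proper subspace lies in the kernel of
  -- one of them.
  refine ⟨(univ.filter (· ≠ 0)).image y, ?_, ?_, ?_⟩
  · refine (Finset.card_image_le.trans (Finset.card_le_univ _)).trans_eq ?_
    rw [Module.card_eq_pow_finrank (K := ZMod 2), Subspace.dual_finrank_eq, ZMod.card]
  · intro z hz
    obtain ⟨φ, hφ, rfl⟩ := Finset.mem_image.mp hz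
    obtain ⟨S, hS⟩ := DFunLike.ne_iff.mp (Finset.mem_filter.mp hφ).2
    exact ⟨S, S.2, by rw [← hy]; exact hS⟩
  · intro U hU hne
    obtain ⟨S, hSW, hSU⟩ := SetLike.exists_of_lt (lt_of_le_of_ne hU hne)
    obtain ⟨f, hf, hUf⟩ := Submodule.exists_le_ker_of_notMem hSU
    refine ⟨y (f.comp W.subtype), Finset.mem_image_of_mem _ ?_, fun R hR => ?_⟩
    · refine Finset.mem_filter.mpr ⟨Finset.mem_univ _, fun h0 => hf ?_⟩
      exact DFunLike.congr_fun h0 (⟨S, hSW⟩ : W)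
    · rw [← hy _ ⟨R, hU hR⟩]
      exact hUf hR

end FourierSampling

/-! ### Counting sparse concepts by distance from the target. -/

section Counting

variable {n : ℕ}

lemma Concept.dist_nonneg (c d : Concept n) : 0 ≤ c.dist d := by
  rw [Concept.dist]
  positivity

lemma Concept.dist_le_one (c d : Concept n) : c.dist d ≤ 1 := by
  rw [Concept.dist, div_le_one (by positivity)]
  have h := Finset.card_le_univ ({x | c x ≠ d x} : Finset (Cube n))
  rw [card_cube] at h
  exact_mod_cast h

lemma Concept.dist_le_add (e c d : Concept n) : c.dist d ≤ e.dist c + e.dist d := by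
  classical
  simp only [Concept.dist, ← add_div]
  have h : #{x | c x ≠ d x} ≤ #{x | e x ≠ c x} + #{x | e x ≠ d x} := by
    refine (Finset.card_le_card fun x hx => ?_).trans (Finset.card_union_le _ _)
    simp only [Finset.mem_union, Finset.mem_filter, Finset.mem_univ, true_and] at hx ⊢
    by_contra! h
    exact hx (h.1.symm.trans h.2)
  gcongr
  exact_mod_cast h

/-- The concept that flips `c` where the average of the signed characters `code` correlates
with `c`. -/
noncomputable def decode {W : Submodule (ZMod 2) (Cube n)} {t : ℕ} (c : Concept n) (L : ℝ)
    (code : Fin t → W × ℤˣ) : Concept n := fun x =>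
  if t / (2 * L) < ∑ i, c.toReal x * (((code i).2 : ℤ) * character (code i).1 x)
  then -c x else c x

/-- A concept whose difference from `c` has small Fourier `ℓ¹` norm is approximated by decoding
few signed characters. -/
lemma exists_code (W : Submodule (ZMod 2) (Cube n)) [Fintype W] (c d : Concept n)
    (hc : fourierSpan c.toReal ≤ W) (hd : fourierSpan d.toReal ≤ W) {L : ℝ} (hL : 1 ≤ L)
    (hN : ∑ S, |fourierCoeff (fun x => (c.toReal x - d.toReal x) / 2) S| ≤ L) (t : ℕ) :
    ∃ code : Fin t → W × ℤˣ,
      (decode c L code).dist d ≤ Real.exp (-(t * (1 / (4 * L)) ^ 2)) := by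
  classical
  have hL0 : 0 < L := by linarith
  set h : Cube n → ℝ := fun x => (c.toReal x - d.toReal x) / 2 with hh
  set ℓ : Cube n → ℝ := fourierCoeff h with hℓ
  set N := ∑ S, |ℓ S| with hNdef
  have hsupp : ∀ S ∉ W, ℓ S = 0 := by
    intro S hS
    have h1 : fourierCoeff c.toReal S = 0 := by
      by_contra h1
      exact hS (hc (Submodule.subset_span h1))
    have h2 : fourierCoeff d.toReal S = 0 := by
      by_contra h2
      exact hS (hd (Submodule.subset_span h2))
    rw [hℓ, hh, fourierCoeff_half_sub, h1, h2]
    simp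
  have hsumW : ∀ f : Cube n → ℝ, (∀ S ∉ W, f S = 0) → ∑ S : W, f S = ∑ S, f S := by
    intro f hf
    refine Fintype.sum_of_injective _ Subtype.val_injective _ _ (fun S hS => hf S ?_) fun _ => rfl
    simpa using hS
  -- Draw `S` with probability `|ℓ S| / L`, signed by `ℓ S`. The leftover mass `1 - N / L` is split
  -- evenly between the two signs of the trivial character, so it cancels in the mean.
  set w : W × ℤˣ → ℝ := fun p =>
    (|ℓ p.1| + ((p.2 : ℤ) : ℝ) * ℓ p.1) / (2 * L) + (if p.1 = 0 then (1 - N / L) / 2 else 0) with hw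
  have hw0 : ∀ p, 0 ≤ w p := by
    rintro ⟨S, b⟩
    have h1 : N / L ≤ 1 := (div_le_one hL0).mpr hN
    have h2 : 0 ≤ |ℓ S| + ((b : ℤ) : ℝ) * ℓ S := by
      rcases Int.units_eq_one_or b with rfl | rfl
      · simp only [Units.val_one, Int.cast_one, one_mul]
        linarith [neg_abs_le (ℓ S)]
      · simp only [Units.val_neg, Units.val_one, Int.cast_neg, Int.cast_one, neg_mul, one_mul]
        linarith [le_abs_self (ℓ S)]
    have h3 : 0 ≤ (1 - N / L) / 2 := by linarith
    simp only [hw]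
    positivity
  have hw1 : ∑ p, w p = 1 := by
    rw [Fintype.sum_prod_type]
    have h1 : ∀ S : W, ∑ b, w (S, b) = |ℓ S| / L + if S = 0 then 1 - N / L else 0 := by
      intro S
      rw [sum_intUnits]
      simp only [hw, Units.val_one, Units.val_neg, Int.cast_neg, Int.cast_one]
      split_ifs <;> field_simp <;> ring
    simp only [h1]
    rw [Finset.sum_add_distrib, ← Finset.sum_div,
      hsumW (fun S => |ℓ S|) (fun S hS => by simp [hsupp S hS]), ← hNdef, Finset.sum_ite_eq']
    simp
  have hmean : ∀ x, ∑ p, w p * (c.toReal x * (((p.2 : ℤ) : ℝ) * character p.1 x))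
      = c.toReal x * h x / L := by
    intro x
    rw [Fintype.sum_prod_type]
    have h1 : ∀ S : W, ∑ b, w (S, b) * (c.toReal x * (((b : ℤ) : ℝ) * character S x))
        = c.toReal x * (ℓ S * character S x) / L := by
      intro S
      rw [sum_intUnits]
      simp only [hw, Units.val_one, Units.val_neg, Int.cast_neg, Int.cast_one]
      field_simp
      ring
    simp only [h1]
    rw [← Finset.sum_div, ← Finset.mul_sum,
      hsumW (fun S => ℓ S * character S x) (fun S hS => by simp [hsupp S hS]), hℓ,
      sum_fourierCoeff_mul_character]
  have habs : ∀ x (p : W × ℤˣ), |c.toReal x * (((p.2 : ℤ) : ℝ) * character p.1 x)| ≤ 1 := by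
    intro x p
    rw [abs_mul, abs_mul, abs_character, abs_eq_one_of_eq_or (c.toReal_eq_or x)]
    rcases Int.units_eq_one_or p.2 with h1 | h1 <;> simp [h1]
  set E := Real.exp (-(t * (1 / (4 * L)) ^ 2)) with hE
  have hy1 : 1 / (4 * L) ≤ 1 := by
    rw [div_le_one (by positivity)]
    linarith
  -- The sum in `decode` has mean `0` where `c` and `d` agree and `t / L` where they differ. The
  -- parameter `1 / (4 * L)` puts the allowed deviation at the midpoint, which is the threshold.
  have hdev : (t : ℝ) * (2 * (1 / (4 * L))) = t / (2 * L) := by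
    field_simp
    norm_num
  have herr : ∀ x, ∑ code : Fin t → W × ℤˣ with decode c L code x ≠ d x, ∏ i, w (code i) ≤ E := by
    intro x
    by_cases hx : c x = d x
    · refine sum_filter_tail_le (X := fun p => c.toReal x * (((p.2 : ℤ) : ℝ) * character p.1 x))
        hw0 hw1 (habs x) (by positivity) hy1 _ fun code hcode => ?_
      rw [hmean, hdev]
      have h0 : h x = 0 := by simp [hh, Concept.toReal_inj.mpr hx]
      rw [h0]
      by_contra hlt
      refine hcode ?_
      rw [decode, if_neg, hx]
      intro h2
      exact hlt (by simpa using h2.le)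
    · refine sum_filter_tail_le (X := fun p => -(c.toReal x * (((p.2 : ℤ) : ℝ) * character p.1 x)))
        hw0 hw1 (fun p => by rw [abs_neg]; exact habs x p) (by positivity) hy1 _
        fun code hcode => ?_
      simp only [mul_neg, Finset.sum_neg_distrib]
      rw [hmean, hdev]
      have h0 : h x = c.toReal x := half_sub_eq_of_ne (c.toReal_eq_or x) (d.toReal_eq_or x)
        fun h' => hx (Concept.toReal_inj.mp h')
      have h1 : c.toReal x * h x = 1 := by
        rw [h0, ← sq, ← sq_abs, abs_eq_one_of_eq_or (c.toReal_eq_or x), one_pow]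
      rw [h1]
      by_contra hlt
      refine hcode ?_
      have hd : d x = -c x := by
        rcases Int.units_eq_one_or (c x) with h2 | h2 <;>
          rcases Int.units_eq_one_or (d x) with h3 | h3 <;> simp_all
      rw [decode, if_pos, hd]
      have h4 : (t : ℝ) * (1 / L) = t / (2 * L) + t / (2 * L) := by
        field_simp
        norm_num
      linarith
  -- Probabilistic method: the pointwise error bounds, averaged over `x`, bound the expected
  -- distance by `E`, so some code does at least as well.
  by_contra! hall
  have hpow : ∑ code : Fin t → W × ℤˣ, ∏ i, w (code i) = 1 := by
    rw [sum_pow_prod, hw1, one_pow]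
  have hprod0 : ∀ code : Fin t → W × ℤˣ, 0 ≤ ∏ i, w (code i) :=
    fun code => Finset.prod_nonneg fun i _ => hw0 _
  have hlt : E < ∑ code : Fin t → W × ℤˣ, (∏ i, w (code i)) * (decode c L code).dist d := by
    have h1 : E = ∑ code : Fin t → W × ℤˣ, (∏ i, w (code i)) * E := by
      rw [← Finset.sum_mul, hpow, one_mul]
    rw [h1]
    obtain ⟨code, -, hcode⟩ : ∃ code ∈ (univ : Finset (Fin t → W × ℤˣ)), ∏ i, w (code i) ≠ 0 :=
      Finset.exists_ne_zero_of_sum_ne_zero (by rw [hpow]; exact one_ne_zero)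
    refine Finset.sum_lt_sum (fun code _ => mul_le_mul_of_nonneg_left (hall code).le (hprod0 code))
      ⟨code, Finset.mem_univ _, mul_lt_mul_of_pos_left (hall code) ?_⟩
    exact lt_of_le_of_ne (hprod0 code) (Ne.symm hcode)
  have hle : ∑ code : Fin t → W × ℤˣ, (∏ i, w (code i)) * (decode c L code).dist d ≤ E := by
    have h1 : ∀ code : Fin t → W × ℤˣ, (∏ i, w (code i)) * (decode c L code).dist d
        = ∑ x, (if decode c L code x ≠ d x then ∏ i, w (code i) else 0) / 2 ^ n := by
      intro code
      rw [Concept.dist, ← Finset.sum_div, ← Finset.sum_filter, Finset.sum_const, nsmul_eq_mul]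
      ring
    simp only [h1]
    rw [Finset.sum_comm]
    simp only [← Finset.sum_div, ← Finset.sum_filter]
    rw [div_le_iff₀ (by positivity)]
    refine (Finset.sum_le_sum fun x _ => herr x).trans_eq ?_
    rw [Finset.sum_const, Finset.card_univ, card_cube, nsmul_eq_mul]
    push_cast
    ring
  linarith

/-- The number of sparse concepts at a given scale of distance from a sparse concept. -/
lemma card_concepts_at_scale_le (W : Submodule (ZMod 2) (Cube n)) {c : Concept n} {k r a s : ℕ}
    (hk : 0 < k) (hW : Module.finrank (ZMod 2) W ≤ r) (hc : fourierSpan c.toReal ≤ W)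
    (hck : IsFourierSparse k c.toReal) (ha : 1 ≤ a)
    (hs : Real.exp (-(s / 16 : ℝ)) < 1 / (4 * k)) (D : Finset (Concept n))
    (hD : ∀ d ∈ D, fourierSpan d.toReal ≤ W ∧ IsFourierSparse k d.toReal ∧
      2 * k * c.dist d ≤ 2 * a) :
    #D ≤ 2 ^ ((r + 1) * (2 * a * s)) := by
  classical
  have := Fintype.ofFinite W
  have hL : 1 ≤ Real.sqrt (2 * a) := by
    rw [Real.one_le_sqrt]
    have : (1 : ℝ) ≤ a := by exact_mod_cast ha
    linarith
  have hcode : ∀ d : Concept n, ∃ code : Fin (2 * a * s) → W × ℤˣ, d ∈ D →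
      (decode c (Real.sqrt (2 * a)) code).dist d < 1 / (4 * k) := by
    intro d
    by_cases hd : d ∈ D
    · obtain ⟨h1, h2, h3⟩ := hD d hd
      -- The difference is `2k`-sparse, so its squared `ℓ¹` norm is at most `2k` times the distance,
      -- hence at most `2a`. With `2as` characters the exponent becomes `2as / (16 · 2a) = s/16`.
      obtain ⟨code, hcode⟩ := exists_code W c d hc h1 hL (by
        refine Real.le_sqrt_of_sq_le ((sum_abs_fourierCoeff_sq_le (hck.half_sub h2)).trans ?_)
        rw [c.sum_fourierCoeff_half_sub_sq d]
        push_cast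
        linarith) (2 * a * s)
      refine ⟨code, fun _ => hcode.trans_lt ?_⟩
      have h4 : (((2 * a * s : ℕ) : ℝ) * (1 / (4 * Real.sqrt (2 * a))) ^ 2) = s / 16 := by
        have : (a : ℝ) ≠ 0 := by positivity
        rw [div_pow, mul_pow, Real.sq_sqrt (by positivity)]
        push_cast
        field_simp
        norm_num
      rwa [h4]
    · exact ⟨fun _ => (0, 1), fun h => absurd h hd⟩
  choose code hcode using hcode
  -- Concepts sharing a code are both within `1/(4k)` of its decoding, too close to each other to be
  -- distinct.
  have hinj : Set.InjOn code D := by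
    intro d hd e he heq
    by_contra hne
    have h1 := one_le_mul_dist (hD d hd).2.1 (hD e he).2.1 hne
    have h2 := hcode d hd
    have h3 := hcode e he
    rw [← heq] at h3
    have h4 := Concept.dist_le_add (decode c (Real.sqrt (2 * a)) (code d)) d e
    have h5 : d.dist e < 1 / (2 * k) := by
      calc d.dist e < 1 / (4 * k) + 1 / (4 * k) := by linarith
        _ = 1 / (2 * k) := by field_simp; norm_num
    rw [lt_div_iff₀ (by positivity)] at h5
    linarith
  calc #D ≤ Fintype.card (Fin (2 * a * s) → W × ℤˣ) :=
        Finset.card_le_card_of_injOn code (fun _ _ => Finset.mem_univ _) hinj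
    _ = (2 ^ (Module.finrank (ZMod 2) W + 1)) ^ (2 * a * s) := by
        rw [Fintype.card_fun, Fintype.card_prod, Fintype.card_fin,
          Module.card_eq_pow_finrank (K := ZMod 2), ZMod.card, pow_succ]
        rfl
    _ ≤ (2 ^ (r + 1)) ^ (2 * a * s) := by gcongr; norm_num
    _ = _ := (pow_mul _ _ _).symm

lemma exp_neg_nat_le (m : ℕ) : Real.exp (-(m : ℝ)) ≤ (1 / 2) ^ m := by
  have h : Real.exp (-1) ≤ 1 / 2 := by
    rw [Real.exp_neg, inv_le_comm₀ (Real.exp_pos _) (by norm_num)]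
    have := Real.add_one_le_exp (1 : ℝ)
    norm_num at this ⊢
    linarith
  calc Real.exp (-(m : ℝ)) = Real.exp (-1) ^ m := by rw [← Real.exp_nat_mul]; congr 1; ring
    _ ≤ _ := by gcongr

lemma sum_geometric_eighth (m : ℕ) :
    ∑ a ∈ Finset.Icc 1 m, (1 / 8 : ℝ) ^ a = (1 - (1 / 8) ^ m) / 7 := by
  induction m with
  | zero => simp
  | succ m ih =>
    rw [Finset.sum_Icc_succ_top (by omega), ih]
    ring

/-- The expected number of wrong sparse concepts that are consistent with random examples. -/
lemma sum_one_sub_dist_pow_le (W : Submodule (ZMod 2) (Cube n)) {c : Concept n} {k r s : ℕ}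
    (hk : 0 < k) (hW : Module.finrank (ZMod 2) W ≤ r) (hc : fourierSpan c.toReal ≤ W)
    (hck : IsFourierSparse k c.toReal) (hs : Real.exp (-(s / 16 : ℝ)) < 1 / (4 * k))
    (D : Finset (Concept n))
    (hD : ∀ d ∈ D, fourierSpan d.toReal ≤ W ∧ IsFourierSparse k d.toReal ∧ d ≠ c) :
    ∑ d ∈ D, (1 - c.dist d) ^ (2 * k * ((r + 1) * (2 * s) + 3)) ≤ 1 / 7 := by
  -- At scale `a` there are at most `2^((r+1)·2as)` concepts, each surviving with probability at
  -- most `2^(-aM)`. The first term of `M` cancels the count, and the `3` leaves `8^(-a)`.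
  set M := (r + 1) * (2 * s) + 3 with hM
  have hmaps : ∀ d ∈ D, ⌊2 * k * c.dist d⌋₊ ∈ Finset.Icc 1 (2 * k) := by
    intro d hd
    have h1 := one_le_mul_dist hck (hD d hd).2.1 (hD d hd).2.2.symm
    rw [Finset.mem_Icc]
    refine ⟨Nat.le_floor (by exact_mod_cast h1), Nat.floor_le_of_le ?_⟩
    push_cast
    exact mul_le_of_le_one_right (by positivity) (c.dist_le_one d)
  rw [← Finset.sum_fiberwise_of_maps_to hmaps]
  have hfib : ∀ a ∈ Finset.Icc 1 (2 * k),
      ∑ d ∈ D with ⌊2 * k * c.dist d⌋₊ = a, (1 - c.dist d) ^ (2 * k * M) ≤ (1 / 8) ^ a := by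
    intro a ha
    have ha1 := (Finset.mem_Icc.mp ha).1
    have hcard : #{d ∈ D | ⌊2 * k * c.dist d⌋₊ = a} ≤ 2 ^ ((r + 1) * (2 * a * s)) := by
      refine card_concepts_at_scale_le W hk hW hc hck ha1 hs _ fun d hd => ?_
      obtain ⟨hd1, hd2⟩ := Finset.mem_filter.mp hd
      refine ⟨(hD d hd1).1, (hD d hd1).2.1, ?_⟩
      have h1 := Nat.lt_floor_add_one (2 * k * c.dist d)
      rw [hd2] at h1
      have : (1 : ℝ) ≤ a := by exact_mod_cast ha1
      linarith
    have hterm : ∀ d ∈ ({d ∈ D | ⌊2 * k * c.dist d⌋₊ = a} : Finset (Concept n)),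
        (1 - c.dist d) ^ (2 * k * M) ≤ (1 / 2) ^ (a * M) := by
      intro d hd
      have hd2 := (Finset.mem_filter.mp hd).2
      have h1 : (a : ℝ) ≤ 2 * k * c.dist d := by
        rw [← hd2]
        exact Nat.floor_le (mul_nonneg (by positivity) (c.dist_nonneg d))
      calc (1 - c.dist d) ^ (2 * k * M) ≤ Real.exp (-c.dist d) ^ (2 * k * M) :=
            pow_le_pow_left₀ (by linarith [c.dist_le_one d]) (Real.one_sub_le_exp_neg _) _
        _ = Real.exp (-(2 * k * c.dist d * M)) := by
            rw [← Real.exp_nat_mul]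
            congr 1
            push_cast
            ring
        _ ≤ Real.exp (-((a * M : ℕ) : ℝ)) := by
            push_cast
            gcongr
        _ ≤ _ := exp_neg_nat_le _
    calc _ ≤ ∑ d ∈ D with ⌊2 * k * c.dist d⌋₊ = a, (1 / 2 : ℝ) ^ (a * M) :=
          Finset.sum_le_sum hterm
      _ = #{d ∈ D | ⌊2 * k * c.dist d⌋₊ = a} * (1 / 2 : ℝ) ^ (a * M) := by
          rw [Finset.sum_const, nsmul_eq_mul]
      _ ≤ 2 ^ ((r + 1) * (2 * a * s)) * (1 / 2 : ℝ) ^ (a * M) := by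
          gcongr
          exact_mod_cast hcard
      _ = (1 / 8) ^ a := by
          have h1 : a * M = (r + 1) * (2 * a * s) + 3 * a := by rw [hM]; ring
          rw [h1, pow_add, ← mul_assoc, ← mul_pow, pow_mul (1 / 2 : ℝ)]
          norm_num
  refine (Finset.sum_le_sum hfib).trans ?_
  rw [sum_geometric_eighth]
  have : (0 : ℝ) ≤ (1 / 8) ^ (2 * k) := by positivity
  linarith

end Counting

lemma sum_biUnion_le_sum {ι Ω : Type*} [DecidableEq Ω] {P : Ω → ℝ} (hP : ∀ o, 0 ≤ P o)
    (s : Finset ι) (A : ι → Finset Ω) : ∑ o ∈ s.biUnion A, P o ≤ ∑ y ∈ s, ∑ o ∈ A y, P o := by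
  classical
  induction s using Finset.induction_on with
  | empty => simp
  | insert a s ha ih =>
    rw [Finset.biUnion_insert, Finset.sum_insert ha]
    have h := Finset.sum_union_inter (s₁ := A a) (s₂ := s.biUnion A) (f := P)
    have h0 : 0 ≤ ∑ o ∈ A a ∩ s.biUnion A, P o := Finset.sum_nonneg fun o _ => hP o
    linarith

/-! ### The learner and its failure probability. -/

section Learner

variable {n : ℕ}

/-- `h` is a sparse concept compatible with the outcomes `o`: its Fourier span is the span of the
first `m` (Fourier) samples, and it is consistent with the remaining `l` examples. -/
def IsCompatible (k : ℕ) {m l : ℕ} (o : Fin (m + l) → ExampleBasis n) (h : Concept n) : Prop :=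
  IsFourierSparse k h.toReal ∧
    fourierSpan h.toReal ≤ Submodule.span (ZMod 2) (Set.range fun i => (o (Fin.castAdd l i)).1) ∧
    ∀ j, (o (Fin.natAdd m j)).2 = h (o (Fin.natAdd m j)).1

open Classical in
/-- The hypothesis computed from the outcomes: any compatible sparse concept. -/
noncomputable def hypothesis (k : ℕ) {m l : ℕ} (o : Fin (m + l) → ExampleBasis n) : Concept n :=
  if h : ∃ d, IsCompatible k o d then h.choose else 1

/-- The default value `1` plays no role once the target is compatible. -/
lemma isCompatible_hypothesis {k m l : ℕ} {o : Fin (m + l) → ExampleBasis n} {c : Concept n}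
    (h : IsCompatible k o c) : IsCompatible k o (hypothesis k o) := by
  have h' : ∃ d, IsCompatible k o d := ⟨c, h⟩
  rw [hypothesis, dif_pos h']
  exact h'.choose_spec

/-- The learner that Fourier samples `m` examples and measures `l` examples in the computational
basis. -/
noncomputable def sparseLearner (n k m l : ℕ) : QuantumLearner n (m + l) :=
  measureLearner (Fin.addCases (fun _ => fourierMatrix n) fun _ => 1)
    (by
      rw [Fin.forall_fin_add]
      simp only [Fin.addCases_left, Fin.addCases_right]
      exact ⟨fun _ => fourierMatrix_conjTranspose_mul_self, fun _ => by simp⟩)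
    (hypothesis k)

lemma outputProb_sparseLearner (k m l : ℕ) (c h : Concept n) :
    (sparseLearner n k m l).outputProb c h = ∑ o : Fin (m + l) → ExampleBasis n
      with hypothesis k o = h, (∏ i, fourierProb c (o (Fin.castAdd l i))) *
        ∏ j, sampleProb c (o (Fin.natAdd m j)) := by
  rw [sparseLearner, outputProb_measureLearner]
  refine Finset.sum_congr rfl fun o _ => ?_
  simp only [Fin.prod_univ_add, Fin.addCases_left, Fin.addCases_right,
    norm_sq_fourierMatrix_mulVec, norm_sq_one_mulVec]

/-- There are two ways to fail: the Fourier samples miss part of the span (at most `1/8`), or a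
wrong sparse concept on the span fits every label (at most `1/7`). Together these stay below `1/3`.
-/
lemma two_thirds_le_outputProb_sparseLearner {k r s : ℕ} (hk : 0 < k)
    (hs : Real.exp (-(s / 16 : ℝ)) < 1 / (4 * k)) {c : Concept n} (hc : c ∈ sparseClass n k r) :
    1 - 1 / 3 ≤ (sparseLearner n k (2 * k * (r + 3))
      (2 * k * ((r + 1) * (2 * s) + 3))).outputProb c c := by
  classical
  obtain ⟨hck, hcr⟩ := hc
  set m := 2 * k * (r + 3) with hm
  set l := 2 * k * ((r + 1) * (2 * s) + 3) with hl
  set W := fourierSpan c.toReal with hW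
  set P : (Fin (m + l) → ExampleBasis n) → ℝ := fun o =>
    (∏ i, fourierProb c (o (Fin.castAdd l i))) * ∏ j, sampleProb c (o (Fin.natAdd m j)) with hP
  have hP0 : ∀ o, 0 ≤ P o := fun o => mul_nonneg
    (Finset.prod_nonneg fun _ _ => fourierProb_nonneg c _)
    (Finset.prod_nonneg fun _ _ => sampleProb_nonneg c _)
  obtain ⟨Y, hYcard, hYW, hY⟩ := exists_separating_finset W
  set D : Finset (Concept n) := {d | fourierSpan d.toReal ≤ W ∧ IsFourierSparse k d.toReal ∧ d ≠ c}
    with hD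
  set A : Cube n → Finset (Fin (m + l) → ExampleBasis n) := fun y =>
    {o | ∀ i, (o (Fin.castAdd l i)).1 ⬝ᵥ y = 0} with hA
  set B : Concept n → Finset (Fin (m + l) → ExampleBasis n) := fun d =>
    {o | ∀ j, (o (Fin.natAdd m j)).2 = d (o (Fin.natAdd m j)).1} with hB
  have hPA : ∀ y ∈ Y, ∑ o ∈ A y, P o ≤ (1 / 2) ^ (r + 3) := by
    intro y hy
    have h1 : ∑ o ∈ A y, P o = (∑ o with o.1 ⬝ᵥ y = 0, fourierProb c o) ^ m :=
      sum_filter_prod_left (sum_sampleProb c) fun o : ExampleBasis n => o.1 ⬝ᵥ y = 0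
    rw [h1]
    have hk' : (k : ℝ) ≠ 0 := by positivity
    calc _ ≤ Real.exp (-(1 / (2 * k))) ^ m := by
          refine pow_le_pow_left₀ (Finset.sum_nonneg fun _ _ => fourierProb_nonneg c _)
            ((sum_fourierProb_filter_le hk hck (hYW y hy)).trans (Real.one_sub_le_exp_neg _)) _
      _ = Real.exp (-((r + 3 : ℕ) : ℝ)) := by
          rw [← Real.exp_nat_mul]
          congr 1
          rw [hm]
          push_cast
          field_simp
      _ ≤ _ := exp_neg_nat_le _
  have hPY : ∑ y ∈ Y, ∑ o ∈ A y, P o ≤ 1 / 8 := by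
    calc _ ≤ ∑ y ∈ Y, (1 / 2 : ℝ) ^ (r + 3) := Finset.sum_le_sum hPA
      _ = #Y * (1 / 2 : ℝ) ^ (r + 3) := by rw [Finset.sum_const, nsmul_eq_mul]
      _ ≤ 2 ^ r * (1 / 2 : ℝ) ^ (r + 3) := by
          gcongr
          exact_mod_cast hYcard.trans (Nat.pow_le_pow_right (by norm_num) hcr)
      _ = 1 / 8 := by
          rw [pow_add, ← mul_assoc, ← mul_pow]
          norm_num
  have hPD : ∑ d ∈ D, ∑ o ∈ B d, P o ≤ 1 / 7 := by
    have h1 : ∀ d, ∑ o ∈ B d, P o = (1 - c.dist d) ^ l := by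
      intro d
      rw [← sum_sampleProb_filter_agree]
      exact sum_filter_prod_right (sum_fourierProb c) fun o : ExampleBasis n => o.2 = d o.1
    simp only [h1]
    exact sum_one_sub_dist_pow_le W hk hcr le_rfl hck hs D fun d hd => (Finset.mem_filter.mp hd).2
  -- On outcomes of positive probability the samples lie in `W` and the labels are those of `c`. If
  -- the samples also span `W`, then `c` is compatible, and a wrong output must be a member of `D`
  -- that fits the labels.
  have hcover : ∀ o, P o ≠ 0 → hypothesis k o ≠ c → (∃ y ∈ Y, o ∈ A y) ∨ ∃ d ∈ D, o ∈ B d := by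
    intro o ho hne
    simp only [hP, mul_ne_zero_iff, Finset.prod_ne_zero_iff, Finset.mem_univ, true_implies] at ho
    set U := Submodule.span (ZMod 2) (Set.range fun i => (o (Fin.castAdd l i)).1) with hU
    have hUW : U ≤ W := by
      rw [hU, Submodule.span_le]
      rintro _ ⟨i, rfl⟩
      exact mem_fourierSpan_of_fourierProb_ne_zero (ho.1 i)
    by_cases hUW' : U = W
    · right
      have hcomp : IsCompatible k o c := by
        refine ⟨hck, hUW'.ge, fun j => ?_⟩
        by_contra h
        exact ho.2 j (by rw [sampleProb, if_neg h])
      obtain ⟨h1, h2, h3⟩ := isCompatible_hypothesis hcomp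
      exact ⟨hypothesis k o, Finset.mem_filter.mpr ⟨Finset.mem_univ _, h2.trans hUW, h1, hne⟩,
        Finset.mem_filter.mpr ⟨Finset.mem_univ _, h3⟩⟩
    · left
      obtain ⟨y, hy, hUy⟩ := hY U hUW hUW'
      exact ⟨y, hy, Finset.mem_filter.mpr ⟨Finset.mem_univ _, fun i =>
        hUy _ (Submodule.subset_span ⟨i, rfl⟩)⟩⟩
  have hfail : ∑ o with ¬ hypothesis k o = c, P o
      ≤ ∑ y ∈ Y, ∑ o ∈ A y, P o + ∑ d ∈ D, ∑ o ∈ B d, P o := by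
    calc ∑ o with ¬ hypothesis k o = c, P o ≤ ∑ o ∈ Y.biUnion A ∪ D.biUnion B, P o := by
          rw [← Finset.sum_filter_ne_zero]
          refine Finset.sum_le_sum_of_subset_of_nonneg (fun o ho => ?_) fun o _ _ => hP0 o
          obtain ⟨ho, ho0⟩ := Finset.mem_filter.mp ho
          rw [Finset.mem_union, Finset.mem_biUnion, Finset.mem_biUnion]
          exact hcover o ho0 (Finset.mem_filter.mp ho).2
      _ ≤ ∑ o ∈ Y.biUnion A, P o + ∑ o ∈ D.biUnion B, P o := by
          rw [← Finset.sum_union_inter]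
          exact le_add_of_nonneg_right (Finset.sum_nonneg fun o _ => hP0 o)
      _ ≤ _ := add_le_add (sum_biUnion_le_sum hP0 Y A) (sum_biUnion_le_sum hP0 D B)
  have htotal : ∑ o, P o = 1 := by
    have h1 := sum_filter_prod_left (m := m) (l := l) (p := fourierProb c) (sum_sampleProb c)
      fun _ : ExampleBasis n => True
    simpa [sum_fourierProb] using h1
  have hsplit := Finset.sum_filter_add_sum_filter_not univ (fun o => hypothesis k o = c) P
  rw [htotal] at hsplit
  rw [outputProb_sparseLearner]
  have hgoal : (1 : ℝ) - 1 / 3 ≤ ∑ o with hypothesis k o = c, P o := by linarith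
  convert hgoal

end Learner

/-- Fixes the accuracy parameter `s = 16(⌊log₂ k⌋ + 3)`, using `e⁻¹ ≤ 1/2` and `k < 2^(⌊log₂ k⌋ +
1)`. -/
lemma exp_neg_log_lt {k : ℕ} (hk : 0 < k) :
    Real.exp (-(((16 * (Nat.log 2 k + 3) : ℕ) : ℝ) / 16)) < 1 / (4 * k) := by
  have h1 : -(((16 * (Nat.log 2 k + 3) : ℕ) : ℝ) / 16) = -((Nat.log 2 k + 3 : ℕ) : ℝ) := by
    push_cast
    ring
  rw [h1]
  refine (exp_neg_nat_le _).trans_lt ?_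
  rw [_root_.one_div_pow]
  refine one_div_lt_one_div_of_lt (by positivity) ?_
  have h2 := Nat.lt_pow_succ_log_self (b := 2) (by norm_num) k
  have h3 : (k : ℝ) < 2 ^ (Nat.log 2 k + 1) := by exact_mod_cast h2
  calc 4 * (k : ℝ) < 4 * 2 ^ (Nat.log 2 k + 1) := by linarith
    _ = 2 ^ (Nat.log 2 k + 3) := by ring

end QLearn

theorem mainTheorem3 :
    ∃ C : ℝ, 0 < C ∧
      ∀ n k r : ℕ, 2 ≤ k → 1 ≤ r →
        ∃ T : ℕ, (T : ℝ) ≤ C * ((r : ℝ) * (k : ℝ) * Real.logb 2 (k : ℝ)) ∧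
          ∃ L : QLearn.QuantumLearner n T,
            L.ExactlyLearns (QLearn.sparseClass n k r) (1 / 3) := by
  refine ⟨1000, by norm_num, fun n k r hk hr => ?_⟩
  refine ⟨2 * k * (r + 3) + 2 * k * ((r + 1) * (2 * (16 * (Nat.log 2 k + 3))) + 3), ?_,
    QLearn.sparseLearner n k _ _, fun c hc => ?_⟩
  · have hk2 : (2 : ℝ) ≤ k := by exact_mod_cast hk
    have hr1 : (1 : ℝ) ≤ r := by exact_mod_cast hr
    have h1 : (1 : ℝ) ≤ Real.logb 2 k := by
      rw [Real.le_logb_iff_rpow_le (by norm_num) (by linarith), Real.rpow_one]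
      exact hk2
    have h2 : (Nat.log 2 k : ℝ) ≤ Real.logb 2 k := by
      exact_mod_cast Real.natLog_le_logb k 2
    set x := Real.logb 2 (k : ℝ)
    have h3 : (1 : ℝ) ≤ r * x := by nlinarith
    have h4 : (r : ℝ) ≤ r * x := le_mul_of_one_le_right (by linarith) h1
    have h5 : ((r : ℝ) + 1) * (Nat.log 2 k + 3) ≤ (2 * r) * (4 * x) :=
      mul_le_mul (by linarith) (by linarith) (by positivity) (by positivity)
    -- The left factor is `2r + 12 + 64(r+1)(⌊log₂ k⌋ + 3)`, at most `(2 + 12 + 512) r x`, so `1000`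
    -- leaves room to spare.
    have h6 : (k : ℝ) * (2 * (r + 3) + 2 * ((r + 1) * (2 * (16 * (Nat.log 2 k + 3))) + 3))
        ≤ k * (1000 * (r * x)) := by
      gcongr
      linarith
    push_cast
    linarith
  · exact QLearn.two_thirds_le_outputProb_sparseLearner (by omega)
      (QLearn.exp_neg_log_lt (by omega)) hc
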